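/- **Setting.** Let $d\ge 1$, let $\mathcal H$ be a separable complex Hilbert space, and let $\mathcal F=\mathcal H\otimes\mathcal F_{\mathrm b}(L^2(\mathbb R^d))\cong\bigoplus_{n\ge0}L^2_{\mathrm{sym}}((\mathbb R^d)^n;\mathcal H)$, where $\mathcal F_{\mathrm b}$ is the boson Fock space. Inner products are linear in the second argument. Let $A$ be a self-adjoint operator in $\mathcal H$ that is bounded from below, and let $\omega:\mathbb R^d\to[0,\infty)$ be continuous with $\omega(k)>0$ for $k\neq0$ and $\inf_{|k|>\varepsilon}\omega(k)>0$ for every $\varepsilon>0$. Put $H_0=A\otimes I+I\otimes d\Gamma(\omega)$ on $D(A\otimes I)\cap D(I\otimes d\Gamma(\omega))$. Let $H_{\mathrm I}$ be an operator in $\mathcal F$ such that $H_{\rm QFT}=H_0+H_{\mathrm I}$, with domain $D(H_0)\cap D(H_{\mathrm I})$, is self-adjoint. Put $E_0=\inf\sigma(H_{\rm QFT})$ and $\widehat H_{\rm QFT}=H_{\rm QFT}-E_0$. A *ground state* is a vector $\Psi\ne0$ with $\widehat H_{\rm QFT}\Psi=0$ (in particular, it is understood that $E_0>-\infty$). Assume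 that there is a ground state $\Psi_{\rm QFT}$ and that $(B_{\rm PT}(k))_{k\in\mathbb R^d\setminus\{0\}}$ is a family of operators in $\mathcal F$ with the following properties. 1. $D(B_{\rm PT}(k))\supset D(H_0)$ for every $k\ne0$. The function $k\mapsto(\Phi,B_{\rm PT}(k)\Psi)_{\mathcal F}$ is measurable for all $\Psi\in D(H_0)$ and $\Phi\in\mathcal F$. The pull-through formula $$a(f)\Psi_{\rm QFT}=-\int_{\mathbb R^d}\overline{f(k)}\,(\widehat H_{\rm QFT}+\omega(k))^{-1}B_{\rm PT}(k)\Psi_{\rm QFT}\,dk$$ holds for every $f\in C_0^\infty(\mathbb R^d\setminus\{0\})$, where $a(f)$ is the annihilation operator. That is, $\Psi_{\rm QFT}\in D(a(f))$, the integrand is integrable, and the two sides are equal. 2. $(\widehat H_{\rm QFT}+\omega(k))^{-1}B_{\rm PT}(k)$ is bounded for every $k\neq0$, and $\int_{|k|>\varepsilon}\|(\widehat H_{\rm QFT}+\omega(k))^{-1}B_{\rm PT}(k)\|^2dk<\infty$ for every $\varepsilon>0$. Let $T_{\rm PT}:\mathcal F\to L^2(\mathbb R^d)$ be the maximal Carleman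 operator induced by $K_{\rm PT}(k)=(\widehat H_{\rm QFT}+\omega(k))^{-1}B_{\rm PT}(k)\Psi_{\rm QFT}$, that is, $(T_{\rm PT}\Phi)(k)=(K_{\rm PT}(k),\Phi)_{\mathcal F}$ with $$D(T_{\rm PT})=\{\Phi\in\mathcal F:\ (K_{\rm PT}(\cdot),\Phi)_{\mathcal F}\in L^2(\mathbb R^d)\}.$$ **Theorem.** If, moreover, $B_{\rm PT}(k)$ is a bounded operator on $\mathcal F$ for every $k\in\mathbb R^d\setminus\{0\}$ and $\|B_{\rm PT}(\cdot)\|_{\mathcal B(\mathcal F)}\in L^2(\mathbb R^d)$, then $$R(\widehat H_{\rm QFT})=\{\widehat H_{\rm QFT}\Psi:\Psi\in D(\widehat H_{\rm QFT})\}\subset D(T_{\rm PT}).$$ -/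

import Mathlib

open MeasureTheory

open scoped ENNReal

noncomputable section

namespace BoseField

/-! ## Unbounded operators in a Hilbert space -/

section Operators

variable {E F : Type*} [NormedAddCommGroup E] [InnerProductSpace ℂ E]
  [NormedAddCommGroup F] [InnerProductSpace ℂ F]

/-- `T + c`, with the same domain as `T`. -/
def addConst (T : E →ₗ.[ℂ] E) (c : ℂ) : E →ₗ.[ℂ] E :=
  (c • (LinearMap.id : E →ₗ[ℂ] E)) +ᵥ T

/-- The bounded, everywhere defined operator `R` is the two-sided inverse `(T - z)⁻¹`. -/
def IsResolventAt (T : E →ₗ.[ℂ] E) (z : ℂ) (R : E →L[ℂ] E) : Prop :=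
  (∀ y : E, ∃ h : R y ∈ T.domain, T ⟨R y, h⟩ - z • R y = y) ∧
    ∀ x : T.domain, R (T x - z • (x : E)) = x

/-- The resolvent set of an operator. -/
def resolventSet (T : E →ₗ.[ℂ] E) : Set ℂ := {z | ∃ R : E →L[ℂ] E, IsResolventAt T z R}

/-- The spectrum of an operator. -/
def spectrum (T : E →ₗ.[ℂ] E) : Set ℂ := (resolventSet T)ᶜ

open scoped Classical in
/-- The resolvent `(T - z)⁻¹` (by convention `0` when `z` lies in the spectrum). -/
def resolvent (T : E →ₗ.[ℂ] E) (z : ℂ) : E →L[ℂ] E :=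
  if h : z ∈ resolventSet T then h.choose else 0

theorem resolvent_spec {T : E →ₗ.[ℂ] E} {z : ℂ} (h : z ∈ resolventSet T) :
    IsResolventAt T z (resolvent T z) := by
  unfold resolvent
  rw [dif_pos h]
  exact h.choose_spec

/-- The spectrum of `T` intersected with the real line; all of it if `T` is self-adjoint. -/
def realSpectrum (T : E →ₗ.[ℂ] E) : Set ℝ := {x | (x : ℂ) ∈ spectrum T}

/-- The ground state energy `inf σ(T)`; used only when the spectrum is bounded below. -/
def groundStateEnergy (T : E →ₗ.[ℂ] E) : ℝ := sInf (realSpectrum T)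

/-- `T̂ = T - inf σ(T)`. -/
def hat (T : E →ₗ.[ℂ] E) : E →ₗ.[ℂ] E := addConst T (-(groundStateEnergy T : ℂ))

/-- `Ψ` is a ground state of `T`: `inf σ(T)` is finite and `Ψ` is a nonzero vector in the kernel of
`T - inf σ(T)`. -/
def IsGroundState (T : E →ₗ.[ℂ] E) (Ψ : E) : Prop :=
  BddBelow (realSpectrum T) ∧ Ψ ≠ 0 ∧
    ∃ h : Ψ ∈ (hat T).domain, hat T ⟨Ψ, h⟩ = 0

/-- `T` is bounded from below as a quadratic form. -/
def IsBoundedBelow (T : E →ₗ.[ℂ] E) : Prop :=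
  ∃ m : ℝ, ∀ x : T.domain, m * ‖(x : E)‖ ^ 2 ≤ (inner ℂ (x : E) (T x)).re

/-- The operator norm `sup {‖T x‖ : x ∈ D(T), ‖x‖ ≤ 1}`, equal to `∞` if `T` is unbounded. -/
def opNorm (T : E →ₗ.[ℂ] F) : ℝ≥0∞ := ⨆ x : {x : T.domain // ‖(x : E)‖ ≤ 1}, ‖T x.1‖ₑ

/-- `T` is a bounded operator on the whole space. -/
def IsBoundedOperator (T : E →ₗ.[ℂ] F) : Prop := T.domain = ⊤ ∧ opNorm T < ∞

open scoped Classical in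
/-- The value `T x` (by convention `0` outside the domain of `T`). -/
def value (T : E →ₗ.[ℂ] F) (x : E) : F := if h : x ∈ T.domain then T ⟨x, h⟩ else 0

/-- The range of an operator. -/
def range (T : E →ₗ.[ℂ] F) : Submodule ℂ F := LinearMap.range T.toFun

end Operators

/-! ## The state space `𝓕 = 𝓗 ⊗ 𝓕_b(L²(ℝᵈ))`, realised as `⨁ₙ L²_sym((ℝᵈ)ⁿ; 𝓗)` -/

/-- Momentum space `ℝᵈ`. -/
abbrev Mom (d : ℕ) : Type := EuclideanSpace ℝ (Fin d)

section Fock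

variable (d : ℕ) (𝓗 : Type*) [NormedAddCommGroup 𝓗] [InnerProductSpace ℂ 𝓗]

theorem measurePreserving_perm (n : ℕ) (σ : Equiv.Perm (Fin n)) :
    MeasurePreserving (fun k : Fin n → Mom d => k ∘ σ) volume volume := by
  have h := volume_measurePreserving_piCongrLeft (fun _ : Fin n => Mom d) σ.symm
  have e : (fun k : Fin n → Mom d => k ∘ σ) =
      MeasurableEquiv.piCongrLeft (fun _ : Fin n => Mom d) σ.symm := by
    funext k i
    obtain ⟨j, rfl⟩ := σ.symm.surjective i
    rw [MeasurableEquiv.coe_piCongrLeft, Equiv.piCongrLeft_apply_apply]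
    simp
  rw [e]
  exact h

/-- `L²_sym((ℝᵈ)ⁿ; 𝓗)`: the square-integrable `𝓗`-valued functions of `n` momenta that are
invariant under permutations of the momenta. For `n = 0` this is a copy of `𝓗`. -/
def symL2 (n : ℕ) : Submodule ℂ (Lp 𝓗 2 (volume : Measure (Fin n → Mom d))) where
  carrier := {f | ∀ σ : Equiv.Perm (Fin n), ∀ᵐ k : Fin n → Mom d, f (k ∘ σ) = f k}
  zero_mem' := by
    intro σ
    have h0 := Lp.coeFn_zero 𝓗 2 (volume : Measure (Fin n → Mom d))
    have h1 := (measurePreserving_perm d n σ).quasiMeasurePreserving.ae h0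
    filter_upwards [h0, h1] with k a b
    rw [a, b]; rfl
  add_mem' := by
    intro f g hf hg σ
    have h0 := Lp.coeFn_add f g
    have h1 := (measurePreserving_perm d n σ).quasiMeasurePreserving.ae h0
    filter_upwards [h0, h1, hf σ, hg σ] with k a b c e
    rw [a, b, Pi.add_apply, Pi.add_apply, c, e]
  smul_mem' := by
    intro c f hf σ
    have h0 := Lp.coeFn_smul c f
    have h1 := (measurePreserving_perm d n σ).quasiMeasurePreserving.ae h0
    filter_upwards [h0, h1, hf σ] with k a b e
    rw [a, b, Pi.smul_apply, Pi.smul_apply, e]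

theorem isClosed_symL2 (n : ℕ) :
    IsClosed (symL2 d 𝓗 n : Set (Lp 𝓗 2 (volume : Measure (Fin n → Mom d)))) := by
  have e : (symL2 d 𝓗 n : Set (Lp 𝓗 2 (volume : Measure (Fin n → Mom d)))) =
      ⋂ σ : Equiv.Perm (Fin n),
        {f | Lp.compMeasurePreserving _ (measurePreserving_perm d n σ) f = f} := by
    ext f
    rw [Set.mem_iInter]
    refine forall_congr' fun σ => ?_
    have h := Lp.coeFn_compMeasurePreserving f (measurePreserving_perm d n σ)
    constructor
    · intro hf
      exact Lp.ext (h.trans hf)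
    · intro hf
      rw [hf] at h
      exact h.symm
  rw [e]
  refine isClosed_iInter fun σ => isClosed_eq ?_ continuous_id
  exact (Lp.isometry_compMeasurePreserving (measurePreserving_perm d n σ)).continuous

instance instCompleteSpaceSymL2 [CompleteSpace 𝓗] (n : ℕ) : CompleteSpace (symL2 d 𝓗 n) :=
  (isClosed_symL2 d 𝓗 n).completeSpace_coe

/-- The state space `𝓕 = ⨁ₙ L²_sym((ℝᵈ)ⁿ; 𝓗)` (Hilbert space direct sum). -/
abbrev Fock : Type _ := lp (fun n : ℕ => symL2 d 𝓗 n) 2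

variable {d 𝓗}

/-- The `n`-particle component `Ψ⁽ⁿ⁾ : (ℝᵈ)ⁿ → 𝓗` of a state, as a function (defined a.e.). -/
def component (Ψ : Fock d 𝓗) (n : ℕ) : (Fin n → Mom d) → 𝓗 :=
  ((Ψ n : symL2 d 𝓗 n) : Lp 𝓗 2 (volume : Measure (Fin n → Mom d)))

theorem component_zero (n : ℕ) :
    ∀ᵐ k : Fin n → Mom d, component (0 : Fock d 𝓗) n k = 0 :=
  Lp.coeFn_zero 𝓗 2 (volume : Measure (Fin n → Mom d))

theorem component_add (Ψ Φ : Fock d 𝓗) (n : ℕ) :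
    ∀ᵐ k : Fin n → Mom d, component (Ψ + Φ) n k = component Ψ n k + component Φ n k :=
  Lp.coeFn_add ((Ψ n : symL2 d 𝓗 n) : Lp 𝓗 2 (volume : Measure (Fin n → Mom d))) (Φ n).1

theorem component_smul (c : ℂ) (Ψ : Fock d 𝓗) (n : ℕ) :
    ∀ᵐ k : Fin n → Mom d, component (c • Ψ) n k = c • component Ψ n k :=
  Lp.coeFn_smul c ((Ψ n : symL2 d 𝓗 n) : Lp 𝓗 2 (volume : Measure (Fin n → Mom d)))

theorem eq_zero_of_component {Ψ : Fock d 𝓗}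
    (h : ∀ n, ∀ᵐ k : Fin n → Mom d, component Ψ n k = 0) : Ψ = 0 := by
  apply lp.ext
  funext n
  apply Subtype.ext
  refine Lp.ext ?_
  filter_upwards [h n, Lp.coeFn_zero 𝓗 2 (volume : Measure (Fin n → Mom d))] with k a b
  exact a.trans b.symm

/-- A property that holds at almost every `(n+1)`-tuple of momenta holds at `(q, k₁, …, kₙ)` for
almost every `(k₁, …, kₙ)` and almost every `q`. -/
theorem ae_ae_cons {n : ℕ} {p : (Fin (n + 1) → Mom d) → Prop}
    (h : ∀ᵐ k : Fin (n + 1) → Mom d, p k) :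
    ∀ᵐ k : Fin n → Mom d, ∀ᵐ q : Mom d, p (Fin.cons q k) := by
  have h1 := (volume_preserving_piFinSuccAbove (fun _ : Fin (n + 1) => Mom d) 0).symm
  have h2 := h1.quasiMeasurePreserving.ae h
  have h3 := (Measure.measurePreserving_swap (μ := (volume : Measure (Fin n → Mom d)))
    (ν := (volume : Measure (Mom d)))).quasiMeasurePreserving.ae h2
  have h4 := Measure.ae_ae_of_ae_prod h3
  filter_upwards [h4] with k hk
  filter_upwards [hk] with q hq
  simpa [MeasurableEquiv.piFinSuccAbove, Fin.insertNthEquiv] using hq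

/-- The graph of `A ⊗ I`: `A` acts on the value of every component at almost every point. -/
def tensorIdGraph (A : 𝓗 →ₗ.[ℂ] 𝓗) : Submodule ℂ (Fock d 𝓗 × Fock d 𝓗) where
  carrier := {p | ∀ n, ∀ᵐ k : Fin n → Mom d, (component p.1 n k, component p.2 n k) ∈ A.graph}
  zero_mem' := by
    intro n
    filter_upwards [component_zero (d := d) (𝓗 := 𝓗) n] with k a
    change (component (0 : Fock d 𝓗) n k, component (0 : Fock d 𝓗) n k) ∈ A.graph
    rw [a]
    exact A.graph.zero_mem
  add_mem' := by
    intro p q hp hq n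
    filter_upwards [hp n, hq n, component_add p.1 q.1 n, component_add p.2 q.2 n] with k a b c e
    rw [Prod.fst_add, Prod.snd_add, c, e]
    exact A.graph.add_mem a b
  smul_mem' := by
    intro c p hp n
    filter_upwards [hp n, component_smul c p.1 n, component_smul c p.2 n] with k a b e
    rw [Prod.smul_fst, Prod.smul_snd, b, e]
    exact A.graph.smul_mem c a

theorem tensorIdGraph_functional (A : 𝓗 →ₗ.[ℂ] 𝓗) (p : Fock d 𝓗 × Fock d 𝓗)
    (hp : p ∈ tensorIdGraph A) (h : p.1 = 0) : p.2 = 0 := by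
  refine eq_zero_of_component fun n => ?_
  filter_upwards [hp n, component_zero (d := d) (𝓗 := 𝓗) n] with k a b
  rw [h, b] at a
  exact A.graph_fst_eq_zero_snd a rfl

/-- The operator `A ⊗ I` on its maximal domain (for self-adjoint `A`, the closure of the algebraic
tensor product of `A` and `I`). -/
def tensorId (A : 𝓗 →ₗ.[ℂ] 𝓗) : Fock d 𝓗 →ₗ.[ℂ] Fock d 𝓗 := (tensorIdGraph A).toLinearPMap

/-- The graph of `I ⊗ dΓ(ω)`: multiplication of `Ψ⁽ⁿ⁾(k₁, …, kₙ)` by `ω(k₁) + ⋯ + ω(kₙ)`. -/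
def secondQuantGraph (ω : Mom d → ℝ) : Submodule ℂ (Fock d 𝓗 × Fock d 𝓗) where
  carrier := {p | ∀ n, ∀ᵐ k : Fin n → Mom d,
    component p.2 n k = ((∑ j, ω (k j) : ℝ) : ℂ) • component p.1 n k}
  zero_mem' := by
    intro n
    filter_upwards [component_zero (d := d) (𝓗 := 𝓗) n] with k a
    change component (0 : Fock d 𝓗) n k = _ • component (0 : Fock d 𝓗) n k
    rw [a, smul_zero]
  add_mem' := by
    intro p q hp hq n
    filter_upwards [hp n, hq n, component_add p.1 q.1 n, component_add p.2 q.2 n] with k a b c e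
    rw [Prod.fst_add, Prod.snd_add, c, e, a, b, smul_add]
  smul_mem' := by
    intro c p hp n
    filter_upwards [hp n, component_smul c p.1 n, component_smul c p.2 n] with k a b e
    rw [Prod.smul_fst, Prod.smul_snd, b, e, a, smul_comm]

theorem secondQuantGraph_functional (ω : Mom d → ℝ) (p : Fock d 𝓗 × Fock d 𝓗)
    (hp : p ∈ secondQuantGraph ω) (h : p.1 = 0) : p.2 = 0 := by
  refine eq_zero_of_component fun n => ?_
  filter_upwards [hp n, component_zero (d := d) (𝓗 := 𝓗) n] with k a b
  rw [a, h, b, smul_zero]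

/-- The operator `I ⊗ dΓ(ω)`, the second quantization of multiplication by `ω`. -/
def secondQuant (ω : Mom d → ℝ) : Fock d 𝓗 →ₗ.[ℂ] Fock d 𝓗 := (secondQuantGraph ω).toLinearPMap

/-- The graph of the annihilation operator `a(f) = I ⊗ a_b(f)`:
`(a(f)Ψ)⁽ⁿ⁾(k₁, …, kₙ) = √(n+1) ∫ conj (f q) Ψ⁽ⁿ⁺¹⁾(q, k₁, …, kₙ) dq`.
(The integrability clause is automatic when `f` is square-integrable.) -/
def annihilationGraph (f : Mom d → ℂ) : Submodule ℂ (Fock d 𝓗 × Fock d 𝓗) where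
  carrier := {p | ∀ n, ∀ᵐ k : Fin n → Mom d,
    Integrable (fun q : Mom d => star (f q) • component p.1 (n + 1) (Fin.cons q k)) ∧
    component p.2 n k = ((Real.sqrt (n + 1) : ℝ) : ℂ) •
      ∫ q : Mom d, star (f q) • component p.1 (n + 1) (Fin.cons q k)}
  zero_mem' := by
    intro n
    filter_upwards [component_zero (d := d) (𝓗 := 𝓗) n,
      ae_ae_cons (component_zero (d := d) (𝓗 := 𝓗) (n + 1))] with k a b
    have e : (fun q : Mom d => star (f q) • component (0 : Fock d 𝓗) (n + 1) (Fin.cons q k))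
        =ᵐ[volume] fun _ => 0 := by
      filter_upwards [b] with q hq
      rw [hq, smul_zero]
    change Integrable (fun q : Mom d =>
        star (f q) • component (0 : Fock d 𝓗) (n + 1) (Fin.cons q k)) ∧
      component (0 : Fock d 𝓗) n k = ((Real.sqrt (n + 1) : ℝ) : ℂ) •
        ∫ q : Mom d, star (f q) • component (0 : Fock d 𝓗) (n + 1) (Fin.cons q k)
    refine ⟨(integrable_zero _ _ _).congr e.symm, ?_⟩
    rw [integral_congr_ae e, a, integral_zero, smul_zero]
  add_mem' := by
    intro p q hp hq n
    filter_upwards [hp n, hq n, component_add p.2 q.2 n,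
      ae_ae_cons (component_add p.1 q.1 (n + 1))] with k a b c e
    have e' : (fun x : Mom d => star (f x) • component (p + q).1 (n + 1) (Fin.cons x k))
        =ᵐ[volume] fun x => star (f x) • component p.1 (n + 1) (Fin.cons x k) +
          star (f x) • component q.1 (n + 1) (Fin.cons x k) := by
      filter_upwards [e] with x hx
      rw [Prod.fst_add, hx, smul_add]
    refine ⟨(a.1.add b.1).congr e'.symm, ?_⟩
    rw [integral_congr_ae e', integral_add a.1 b.1, Prod.snd_add, c, a.2, b.2, smul_add]
  smul_mem' := by
    intro c p hp n
    filter_upwards [hp n, component_smul c p.2 n,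
      ae_ae_cons (component_smul c p.1 (n + 1))] with k a b e
    have e' : (fun x : Mom d => star (f x) • component (c • p).1 (n + 1) (Fin.cons x k))
        =ᵐ[volume] fun x => c • (star (f x) • component p.1 (n + 1) (Fin.cons x k)) := by
      filter_upwards [e] with x hx
      rw [Prod.smul_fst, hx, smul_comm]
    refine ⟨(a.1.smul c).congr e'.symm, ?_⟩
    rw [integral_congr_ae e', integral_smul, Prod.smul_snd, b, a.2, smul_comm]

theorem annihilationGraph_functional (f : Mom d → ℂ) (p : Fock d 𝓗 × Fock d 𝓗)
    (hp : p ∈ annihilationGraph f) (h : p.1 = 0) : p.2 = 0 := by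
  refine eq_zero_of_component fun n => ?_
  filter_upwards [hp n, ae_ae_cons (component_zero (d := d) (𝓗 := 𝓗) (n + 1))] with k a b
  have e : (fun q : Mom d => star (f q) • component p.1 (n + 1) (Fin.cons q k))
      =ᵐ[volume] fun _ => 0 := by
    filter_upwards [b] with q hq
    rw [h, hq, smul_zero]
  rw [a.2, integral_congr_ae e, integral_zero, smul_zero]

/-- The annihilation operator `a(f)` on its maximal domain. -/
def annihilation (f : Mom d → ℂ) : Fock d 𝓗 →ₗ.[ℂ] Fock d 𝓗 := (annihilationGraph f).toLinearPMap

/-- The free Hamiltonian `H₀ = A ⊗ I + I ⊗ dΓ(ω)` with domain `D(A ⊗ I) ∩ D(I ⊗ dΓ(ω))`. -/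
def freeHamiltonian (A : 𝓗 →ₗ.[ℂ] 𝓗) (ω : Mom d → ℝ) : Fock d 𝓗 →ₗ.[ℂ] Fock d 𝓗 :=
  tensorId A + secondQuant ω

/-- The standing assumptions on the dispersion relation. -/
structure IsDispersion (ω : Mom d → ℝ) : Prop where
  continuous : Continuous ω
  nonneg : ∀ k, 0 ≤ ω k
  pos : ∀ k, k ≠ 0 → 0 < ω k
  inf_pos : ∀ ε : ℝ, 0 < ε → ∃ c : ℝ, 0 < c ∧ ∀ k, ε < ‖k‖ → c ≤ ω k

/-! ## The pull-through formula and the maximal Carleman operator -/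

/-- The inducing function `K(k) = (Ĥ + ω(k))⁻¹ B(k) Ψ` (`k ≠ 0`; the value at `k = 0` is
irrelevant). -/
def carlemanKernel (H : Fock d 𝓗 →ₗ.[ℂ] Fock d 𝓗) (ω : Mom d → ℝ)
    (B : Mom d → Fock d 𝓗 →ₗ.[ℂ] Fock d 𝓗) (Ψ : Fock d 𝓗) (k : Mom d) : Fock d 𝓗 :=
  resolvent (hat H) (-(ω k : ℂ)) (value (B k) Ψ)

/-- The operator-theoretical pull-through formula on the state `Ψ`:
`a(f)Ψ = - ∫ conj (f k) (Ĥ + ω(k))⁻¹ B(k) Ψ dk` for every `f ∈ C₀^∞(ℝᵈ ∖ {0})`. -/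
def PullThrough (H : Fock d 𝓗 →ₗ.[ℂ] Fock d 𝓗) (ω : Mom d → ℝ)
    (B : Mom d → Fock d 𝓗 →ₗ.[ℂ] Fock d 𝓗) (Ψ : Fock d 𝓗) : Prop :=
  ∀ f : Mom d → ℂ, ContDiff ℝ ((⊤ : ℕ∞) : WithTop ℕ∞) f → HasCompactSupport f → (0 : Mom d) ∉ tsupport f →
    ∃ h : Ψ ∈ (annihilation (𝓗 := 𝓗) f).domain,
      Integrable (fun k => star (f k) • carlemanKernel H ω B Ψ k) ∧
      annihilation f ⟨Ψ, h⟩ = -∫ k, star (f k) • carlemanKernel H ω B Ψ k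

/-- `B(k)`, `k ≠ 0`, is defined on the subspace `D`, and `B(·)Φ` is weakly measurable for `Φ ∈ D`. -/
def IsMeasurableFamily (D : Submodule ℂ (Fock d 𝓗))
    (B : Mom d → Fock d 𝓗 →ₗ.[ℂ] Fock d 𝓗) : Prop :=
  (∀ k, k ≠ 0 → D ≤ (B k).domain) ∧
    ∀ Φ ∈ D, ∀ Ξ : Fock d 𝓗, AEMeasurable (fun k => inner ℂ Ξ (value (B k) Φ)) volume

/-- `(Ĥ + ω(k))⁻¹ B(k)` is bounded for `k ≠ 0`, and its operator norm is square-integrable over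
`|k| > ε` for every `ε > 0`. -/
def IsRegularAwayFromZero (H : Fock d 𝓗 →ₗ.[ℂ] Fock d 𝓗) (ω : Mom d → ℝ)
    (B : Mom d → Fock d 𝓗 →ₗ.[ℂ] Fock d 𝓗) : Prop :=
  (∀ k, k ≠ 0 →
    opNorm ((resolvent (hat H) (-(ω k : ℂ))).toLinearMap.compPMap (B k)) < ∞) ∧
  ∀ ε : ℝ, 0 < ε → ∫⁻ k in {k : Mom d | ε < ‖k‖},
    opNorm ((resolvent (hat H) (-(ω k : ℂ))).toLinearMap.compPMap (B k)) ^ 2 < ∞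

end Fock

section Carleman

variable {d : ℕ} {E : Type*} [NormedAddCommGroup E] [InnerProductSpace ℂ E]

/-- The domain of the maximal Carleman operator induced by `K`: all `Φ` for which
`k ↦ (K(k), Φ)` is in `L²(ℝᵈ)`. -/
def carlemanDomain (K : Mom d → E) : Submodule ℂ (E) where
  carrier := {Φ | MemLp (fun k => inner ℂ (K k) Φ) 2 volume}
  zero_mem' := by
    change MemLp (fun k => inner ℂ (K k) (0 : E)) 2 volume
    simp only [inner_zero_right]
    exact MemLp.zero
  add_mem' := by
    intro Φ Ξ h1 h2
    change MemLp (fun k => inner ℂ (K k) (Φ + Ξ)) 2 volume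
    simp only [inner_add_right]
    exact MemLp.add h1 h2
  smul_mem' := by
    intro c Φ h
    change MemLp (fun k => inner ℂ (K k) (c • Φ)) 2 volume
    simp only [inner_smul_right]
    exact MemLp.const_smul h c

theorem mem_carlemanDomain {K : Mom d → E} {Φ : E} :
    Φ ∈ carlemanDomain K ↔ MemLp (fun k => inner ℂ (K k) Φ) 2 volume := Iff.rfl

/-- The maximal Carleman operator `T : E → L²(ℝᵈ)` induced by `K`: `(TΦ)(k) = (K(k), Φ)`. -/
def maximalCarleman (K : Mom d → E) :
    E →ₗ.[ℂ] Lp ℂ 2 (volume : Measure (Mom d)) where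
  domain := carlemanDomain K
  toFun :=
    { toFun := fun Φ => MemLp.toLp (fun k => inner ℂ (K k) (Φ : E))
        (mem_carlemanDomain.mp Φ.2)
      map_add' := by
        intro Φ Ξ
        have h1 := mem_carlemanDomain.mp Φ.2
        have h2 := mem_carlemanDomain.mp Ξ.2
        rw [← MemLp.toLp_add h1 h2]
        refine MemLp.toLp_congr _ _ (ae_of_all _ fun k => ?_)
        exact inner_add_right _ _ _
      map_smul' := by
        intro c Φ
        have h1 := mem_carlemanDomain.mp Φ.2
        rw [RingHom.id_apply, ← MemLp.toLp_const_smul c h1]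
        refine MemLp.toLp_congr _ _ (ae_of_all _ fun k => ?_)
        exact inner_smul_right _ _ _ }

end Carleman

end BoseField

end

/-! Write `Ĥ` for `hat HQFT`. It is symmetric and has no negative spectrum, so `(Ĥ + a)⁻¹` is
symmetric with norm at most `1 / a` for `a > 0` (`IsResolventAt.norm_le`). For `Φ = Ĥ η` and `k ≠
0`, symmetry moves the resolvent to the other side: `(K(k), Φ) = (B(k)Ψ, (Ĥ + ω(k))⁻¹ Ĥ η)`. Since
`(Ĥ + ω)⁻¹ Ĥ η = η - ω (Ĥ + ω)⁻¹ η` has norm at most `2‖η‖`, the singularity of `1 / ω(k)` at `k =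
0` cancels, and `2 ‖B(k)‖ ‖Ψ‖ ‖η‖` is a square-integrable bound. Measurability in `k` comes from
pairing the weakly measurable `B(k)Ψ` with `(Ĥ + ω(k))⁻¹ Ĥ η`, which is norm continuous off the
origin (`continuousOn_resolvent`, `aestronglyMeasurable_inner_of_weak`). -/

namespace BoseField

open Filter Topology

/-! ### Resolvents of symmetric operators and their norm bound -/

section Resolvents

variable {E : Type*} [NormedAddCommGroup E] [InnerProductSpace ℂ E]

theorem isResolventAt_addConst {T : E →ₗ.[ℂ] E} {c z : ℂ} {R : E →L[ℂ] E}
    (h : IsResolventAt T (z - c) R) : IsResolventAt (addConst T c) z R := by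
  refine ⟨fun y => ?_, fun x => ?_⟩
  · obtain ⟨hy, e⟩ := h.1 y
    refine ⟨hy, ?_⟩
    refine Eq.trans ?_ e
    change (c • R y + T ⟨R y, hy⟩) - z • R y = _
    rw [sub_smul]
    abel
  · have e := h.2 x
    refine Eq.trans (congrArg R ?_) e
    change (c • (x : E) + T x) - z • (x : E) = T x - (z - c) • (x : E)
    rw [sub_smul]
    abel

/-- If the real spectrum of `T` is bounded below, every negative number is in the resolvent set of
`T - inf σ(T)`. -/
theorem mem_resolventSet_hat {T : E →ₗ.[ℂ] E} (h : BddBelow (realSpectrum T)) {x : ℝ}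
    (hx : x < 0) : (x : ℂ) ∈ resolventSet (hat T) := by
  have h1 : x + groundStateEnergy T ∉ realSpectrum T :=
    notMem_of_lt_csInf (by change _ < groundStateEnergy T; linarith) h
  obtain ⟨R, hR⟩ := not_not.mp h1
  refine ⟨R, isResolventAt_addConst ?_⟩
  simpa using hR

/-- The first resolvent identity. -/
theorem IsResolventAt.sub_eq {T : E →ₗ.[ℂ] E} {z w : ℂ} {R S : E →L[ℂ] E}
    (hR : IsResolventAt T z R) (hS : IsResolventAt T w S) : R - S = (z - w) • (R * S) := by
  ext y
  obtain ⟨hy, e⟩ := hS.1 y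
  -- Apply `R` to `(T - z) S y = y + (w - z) S y`.
  have e' := hR.2 ⟨S y, hy⟩
  rw [eq_add_of_sub_eq e] at e'
  simp only [map_sub, map_add, map_smul] at e'
  change R y - S y = (z - w) • R (S y)
  nth_rewrite 1 [← e']
  rw [sub_smul]
  abel

theorem isFormalAdjoint_addConst {T : E →ₗ.[ℂ] E} (h : T.IsFormalAdjoint T) (c : ℝ) :
    (addConst T c).IsFormalAdjoint (addConst T c) := by
  intro x y
  have e : inner ℂ (T x) (y : E) = inner ℂ (x : E) (T y) := h x y
  change inner ℂ ((c : ℂ) • (x : E) + T x) (y : E) = inner ℂ (x : E) ((c : ℂ) • (y : E) + T y)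
  rw [inner_add_left, inner_add_right, inner_smul_left, inner_smul_right, e, Complex.conj_ofReal]

/-- The resolvent of a symmetric operator at a real point is symmetric. -/
theorem IsResolventAt.isSymmetric {T : E →ₗ.[ℂ] E} (h : T.IsFormalAdjoint T) {z : ℝ}
    {R : E →L[ℂ] E} (hR : IsResolventAt T z R) (x y : E) :
    inner ℂ (R x) y = inner ℂ x (R y) := by
  obtain ⟨hx, ex⟩ := hR.1 x
  obtain ⟨hy, ey⟩ := hR.1 y
  have e : inner ℂ (T ⟨R x, hx⟩) (R y) = inner ℂ (R x) (T ⟨R y, hy⟩) := h ⟨R x, hx⟩ ⟨R y, hy⟩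
  -- Substitute `x = (T - z) R x` and `y = (T - z) R y`; the `z` terms agree because `z` is real.
  nth_rewrite 2 [← ex]
  nth_rewrite 1 [← ey]
  rw [inner_sub_left, inner_sub_right, inner_smul_left, inner_smul_right, e, Complex.conj_ofReal]

/-- The resolvent of a symmetric operator with no negative real spectrum satisfies
`‖(T + a)⁻¹‖ ≤ 1 / a` for `a > 0`. -/
theorem IsResolventAt.norm_le [CompleteSpace E] {T : E →ₗ.[ℂ] E} (h : T.IsFormalAdjoint T)
    (hT : ∀ x : ℝ, x < 0 → (x : ℂ) ∈ resolventSet T) {a : ℝ} (ha : 0 < a) {R : E →L[ℂ] E}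
    (hR : IsResolventAt T (-(a : ℂ)) R) : ‖R‖ ≤ a⁻¹ := by
  have hsa : IsSelfAdjoint R := by
    rw [ContinuousLinearMap.isSelfAdjoint_iff_isSymmetric]
    have hR' : IsResolventAt T ((-a : ℝ) : ℂ) R := by simpa using hR
    exact fun x y => hR'.isSymmetric h x y
  have key : ∀ μ ∈ _root_.spectrum ℂ R, ‖μ‖ ≤ a⁻¹ := by
    intro μ hμ
    have hre := hsa.mem_spectrum_eq_re hμ
    set m : ℝ := μ.re with hm
    rw [hre] at hμ ⊢
    rw [Complex.norm_real, Real.norm_eq_abs]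
    by_contra! hlt
    have hm0 : m ≠ 0 := by
      rintro h0
      rw [h0, abs_zero] at hlt
      exact absurd hlt (not_lt.mpr (inv_pos.mpr ha).le)
    -- A spectral value `m` of `(T + a)⁻¹` would correspond to the point `m⁻¹ - a` of the spectrum
    -- of `T`; if `|m| > a⁻¹`, that point is negative, hence excluded.
    have hx : m⁻¹ - a < 0 := by
      have h1 : |m|⁻¹ < a := inv_lt_of_inv_lt₀ ha hlt
      have h2 : m⁻¹ ≤ |m|⁻¹ := by rw [← abs_inv]; exact le_abs_self _
      linarith
    obtain ⟨S, hS⟩ := hT _ hx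
    have hm0' : (m : ℂ) ≠ 0 := by exact_mod_cast hm0
    -- Both orders are needed: one for each one-sided inverse below.
    have e1 := hS.sub_eq hR
    have e2 := hR.sub_eq hS
    have e3 : (((m⁻¹ - a : ℝ) : ℂ) - -(a : ℂ)) = (m : ℂ)⁻¹ := by push_cast; ring
    have e4 : (-(a : ℂ) - ((m⁻¹ - a : ℝ) : ℂ)) = -(m : ℂ)⁻¹ := by push_cast; ring
    rw [e3] at e1
    rw [e4] at e2
    have e5 : (m : ℂ)⁻¹ • (R * S) = S - R := by
      rw [← neg_sub R S, e2, neg_smul, neg_neg]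
    refine hμ ?_
    -- Formally `m - R = m (T + a - m⁻¹) R`, whose inverse is `m⁻¹ (T + a) S = m⁻¹ (1 + m⁻¹ S)`.
    refine ⟨⟨algebraMap ℂ (E →L[ℂ] E) m - R, (m : ℂ)⁻¹ • (1 + (m : ℂ)⁻¹ • S), ?_, ?_⟩, rfl⟩
    · have e6 : (algebraMap ℂ (E →L[ℂ] E) m - R) * ((m : ℂ)⁻¹ • (1 + (m : ℂ)⁻¹ • S)) =
          1 + (m : ℂ)⁻¹ • (S - R - (m : ℂ)⁻¹ • (R * S)) := by
        simp only [Algebra.algebraMap_eq_smul_one, mul_smul_comm, mul_add, sub_mul, smul_mul_assoc,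
          one_mul, mul_one]
        match_scalars <;> field_simp
      rw [e6, e5, sub_self, smul_zero, add_zero]
    · have e6 : ((m : ℂ)⁻¹ • (1 + (m : ℂ)⁻¹ • S)) * (algebraMap ℂ (E →L[ℂ] E) m - R) =
          1 + (m : ℂ)⁻¹ • (S - R - (m : ℂ)⁻¹ • (S * R)) := by
        simp only [Algebra.algebraMap_eq_smul_one, mul_smul_comm, add_mul, mul_sub, smul_mul_assoc,
          one_mul, mul_one]
        match_scalars <;> field_simp
      rw [e6, ← e1, sub_self, smul_zero, add_zero]
  have hrad : spectralRadius ℂ R ≤ ENNReal.ofReal a⁻¹ := by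
    refine iSup₂_le fun μ hμ => ?_
    rw [← enorm_eq_nnnorm, ← ofReal_norm]
    exact ENNReal.ofReal_le_ofReal (key μ hμ)
  -- Self-adjointness of `R` turns the bound on its spectrum into a bound on its norm.
  rw [hsa.spectralRadius_eq_nnnorm] at hrad
  have := ENNReal.toReal_mono ENNReal.ofReal_ne_top hrad
  rwa [ENNReal.toReal_ofReal (inv_pos.mpr ha).le] at this

/-- Rescale to a unit vector. Finiteness of `opNorm T` is essential, since `toReal` sends `∞` to
`0`. -/
theorem norm_value_le {F : Type*} [NormedAddCommGroup F] [InnerProductSpace ℂ F]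
    {T : E →ₗ.[ℂ] F} (hT : IsBoundedOperator T) (x : E) :
    ‖value T x‖ ≤ (opNorm T).toReal * ‖x‖ := by
  have hx : x ∈ T.domain := hT.1 ▸ Submodule.mem_top
  rw [value, dif_pos hx]
  rcases eq_or_ne x 0 with rfl | h0
  · have : (⟨0, hx⟩ : T.domain) = 0 := rfl
    rw [this, LinearPMap.map_zero]
    simp
  have hn : ‖x‖ ≠ 0 := norm_ne_zero_iff.mpr h0
  set u : T.domain := ((‖x‖⁻¹ : ℝ) : ℂ) • ⟨x, hx⟩ with hu
  have hu1 : ‖(u : E)‖ ≤ 1 := by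
    change ‖((‖x‖⁻¹ : ℝ) : ℂ) • x‖ ≤ 1
    rw [norm_smul, Complex.norm_real, norm_inv, norm_norm, inv_mul_cancel₀ hn]
  have h1 : ‖T u‖ₑ ≤ opNorm T :=
    le_iSup (fun y : {y : T.domain // ‖(y : E)‖ ≤ 1} => ‖T y.1‖ₑ) ⟨u, hu1⟩
  have h2 := ENNReal.toReal_mono hT.2.ne h1
  rw [toReal_enorm, hu, LinearPMap.map_smul, norm_smul, Complex.norm_real, norm_inv, norm_norm,
    inv_mul_le_iff₀ (norm_pos_iff.mpr h0), mul_comm] at h2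
  exact h2

end Resolvents

/-! ### Measurability of inner products -/

section Measurability

variable {α E : Type*} [MeasurableSpace α] {μ : Measure α} [NormedAddCommGroup E]
  [InnerProductSpace ℂ E]

/-- The inner product of a weakly measurable function with a strongly measurable one is
measurable. -/
theorem aestronglyMeasurable_inner_of_weak {b v : α → E}
    (hb : ∀ x : E, AEMeasurable (fun k => inner ℂ x (b k)) μ) (hv : AEStronglyMeasurable v μ) :
    AEStronglyMeasurable (fun k => inner ℂ (b k) (v k)) μ := by
  have hb' : ∀ x : E, AEMeasurable (fun k => inner ℂ (b k) x) μ := fun x => by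
    have := Complex.continuous_conj.measurable.comp_aemeasurable (hb x)
    refine this.congr (ae_of_all _ fun k => ?_)
    exact inner_conj_symm _ _
  obtain ⟨w, hw, hvw⟩ := hv
  -- `E` need not be separable, so `b` may fail to be strongly measurable. Approximating `w` by
  -- simple functions leaves finite sums of pairings of `b` with fixed vectors.
  have hlim : AEMeasurable (fun k => inner ℂ (b k) (w k)) μ := by
    refine aemeasurable_of_tendsto_metrizable_ae atTop
      (f := fun n k => inner ℂ (b k) (hw.approx n k)) (fun n => ?_)
      (ae_of_all _ fun k => tendsto_const_nhds.inner (hw.tendsto_approx k))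
    have e : (fun k => inner ℂ (b k) (hw.approx n k)) = fun k =>
        ∑ x ∈ (hw.approx n).range,
          (hw.approx n ⁻¹' {x}).indicator (fun k => inner ℂ (b k) x) k := by
      funext k
      rw [Finset.sum_eq_single (hw.approx n k)]
      · simp [Set.indicator_of_mem]
      · intro x _ hx
        exact Set.indicator_of_notMem (fun h => hx (Eq.symm h)) _
      · exact fun h => absurd ((hw.approx n).mem_range_self k) h
    rw [e]
    exact Finset.aemeasurable_fun_sum _ fun x _ =>
      (hb' x).indicator ((hw.approx n).measurableSet_fiber x)
  refine hlim.aestronglyMeasurable.congr ?_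
  filter_upwards [hvw] with k hk
  rw [hk]

end Measurability

/-! ### Norm continuity of the resolvent and the Carleman domain -/

section Carleman

variable {d : ℕ} {E : Type*} [NormedAddCommGroup E] [InnerProductSpace ℂ E] [CompleteSpace E]

/-- Norm continuity of `a ↦ (T + a)⁻¹` for `a > 0`. -/
theorem continuousOn_resolvent {T : E →ₗ.[ℂ] E} (h : T.IsFormalAdjoint T)
    (hT : ∀ x : ℝ, x < 0 → (x : ℂ) ∈ resolventSet T) :
    ContinuousOn (fun a : ℝ => resolvent T (-(a : ℂ))) (Set.Ioi 0) := by
  have hspec : ∀ a : ℝ, 0 < a → IsResolventAt T (-(a : ℂ)) (resolvent T (-(a : ℂ))) :=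
    fun a ha => resolvent_spec (by simpa using hT (-a) (by linarith))
  intro a ha
  have ha : 0 < a := ha
  rw [ContinuousWithinAt, tendsto_iff_norm_sub_tendsto_zero]
  -- This majorant is the first resolvent identity combined with the two bounds `1 / b` and `1 / a`.
  refine squeeze_zero' (g := fun b : ℝ => |b - a| * (b⁻¹ * a⁻¹))
    (Eventually.of_forall fun _ => norm_nonneg _) ?_ ?_
  · filter_upwards [self_mem_nhdsWithin] with b hb
    have hb : 0 < b := hb
    rw [(hspec b hb).sub_eq (hspec a ha), norm_smul]
    have e : ‖-(b : ℂ) - -(a : ℂ)‖ = |b - a| := by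
      rw [← norm_neg, ← Real.norm_eq_abs, ← Complex.norm_real]
      congr 1
      push_cast
      ring
    rw [e]
    refine mul_le_mul_of_nonneg_left ((norm_mul_le _ _).trans ?_) (abs_nonneg _)
    exact mul_le_mul ((hspec b hb).norm_le h hT hb) ((hspec a ha).norm_le h hT ha)
      (norm_nonneg _) (inv_pos.mpr hb).le
  · have hc : ContinuousAt (fun b : ℝ => |b - a| * (b⁻¹ * a⁻¹)) a := by
      have := ha.ne'
      fun_prop (disch := assumption)
    have := hc.tendsto
    simp only [sub_self, abs_zero, zero_mul] at this
    exact this.mono_left nhdsWithin_le_nhds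

/-- For a symmetric `T` without negative spectrum, the range of `T` lies in the domain of the
maximal Carleman operator with kernel `(T + ω(k))⁻¹ b(k)`, if `b` is weakly measurable with
square-integrable norm. -/
theorem range_le_carlemanDomain (hd : 0 < d) {T : E →ₗ.[ℂ] E} (h : T.IsFormalAdjoint T)
    (hT : ∀ x : ℝ, x < 0 → (x : ℂ) ∈ resolventSet T) {ω : Mom d → ℝ} (hω : Continuous ω)
    (hpos : ∀ k, k ≠ 0 → 0 < ω k) {b : Mom d → E}
    (hb : ∀ x : E, AEMeasurable (fun k => inner ℂ x (b k)) volume)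
    {g : Mom d → ℝ} (hg : MemLp g 2 volume) (hbg : ∀ k, k ≠ 0 → ‖b k‖ ≤ g k) :
    range T ≤ carlemanDomain (fun k => resolvent T (-(ω k : ℂ)) (b k)) := by
  rintro _ ⟨η, rfl⟩
  change MemLp (fun k => inner ℂ (resolvent T (-(ω k : ℂ)) (b k)) (T η)) 2 volume
  -- For `d > 0` Lebesgue measure has no atoms, so the origin, where `ω` may vanish, is a null set.
  have : Nonempty (Fin d) := ⟨⟨0, hd⟩⟩
  have hspec : ∀ a : ℝ, 0 < a → IsResolventAt T (-(a : ℂ)) (resolvent T (-(a : ℂ))) :=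
    fun a ha => resolvent_spec (by simpa using hT (-a) (by linarith))
  have hne : ∀ᵐ k : Mom d, k ≠ 0 := by
    rw [ae_iff]
    simp
  have hsymm : ∀ k, k ≠ 0 → inner ℂ (resolvent T (-(ω k : ℂ)) (b k)) (T η) =
      inner ℂ (b k) (resolvent T (-(ω k : ℂ)) (T η)) := fun k hk => by
    have hR : IsResolventAt T ((-ω k : ℝ) : ℂ) (resolvent T (-(ω k : ℂ))) := by
      simpa using hspec _ (hpos k hk)
    exact hR.isSymmetric h _ _
  have hv : AEStronglyMeasurable (fun k => resolvent T (-(ω k : ℂ)) (T η)) volume := by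
    have hc : ContinuousOn (fun k => resolvent T (-(ω k : ℂ)) (T η)) ({0}ᶜ : Set (Mom d)) :=
      ((continuousOn_resolvent h hT).comp hω.continuousOn fun k hk => hpos k hk).clm_apply
        continuousOn_const
    have := hc.aestronglyMeasurable (μ := volume) (measurableSet_singleton 0).compl
    have hne' : ∀ᵐ k : Mom d, k ∈ ({0}ᶜ : Set (Mom d)) := hne
    rwa [Measure.restrict_eq_self_of_ae_mem hne'] at this
  refine MemLp.of_le_mul (c := 2 * ‖(η : E)‖) hg ?_ ?_
  · refine (aestronglyMeasurable_inner_of_weak hb hv).congr ?_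
    filter_upwards [hne] with k hk
    exact (hsymm k hk).symm
  · filter_upwards [hne] with k hk
    have hωk := hpos k hk
    have hR := hspec _ hωk
    -- The infrared cancellation: both terms on the right have norm at most `‖η‖`, uniformly in `k`.
    have e : resolvent T (-(ω k : ℂ)) (T η) =
        η - (ω k : ℂ) • resolvent T (-(ω k : ℂ)) (η : E) := by
      rw [← map_smul, eq_sub_iff_add_eq, ← map_add]
      simpa using hR.2 η
    have hle : ‖resolvent T (-(ω k : ℂ)) (T η)‖ ≤ 2 * ‖(η : E)‖ := by
      rw [e]
      refine (norm_sub_le _ _).trans ?_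
      rw [norm_smul, Complex.norm_real, Real.norm_eq_abs, abs_of_pos hωk]
      have h1 : ω k * ‖resolvent T (-(ω k : ℂ)) (η : E)‖ ≤ ω k * ((ω k)⁻¹ * ‖(η : E)‖) :=
        mul_le_mul_of_nonneg_left (ContinuousLinearMap.le_of_opNorm_le _ (hR.norm_le h hT hωk) _)
          hωk.le
      rw [mul_inv_cancel_left₀ hωk.ne'] at h1
      linarith
    rw [hsymm k hk, mul_comm]
    refine (norm_inner_le_norm _ _).trans ?_
    exact mul_le_mul ((hbg k hk).trans (Real.le_norm_self _)) hle (norm_nonneg _) (norm_nonneg _)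

end Carleman

end BoseField

/-! ### Application to the field Hamiltonian -/

theorem mainTheorem4 {d : ℕ} (hd : 0 < d)
    {𝓗 : Type*} [NormedAddCommGroup 𝓗] [InnerProductSpace ℂ 𝓗] [CompleteSpace 𝓗]
    [TopologicalSpace.SeparableSpace 𝓗]
    (A : 𝓗 →ₗ.[ℂ] 𝓗) (hA : IsSelfAdjoint A) (hAbdd : BoseField.IsBoundedBelow A)
    (ω : BoseField.Mom d → ℝ) (hω : BoseField.IsDispersion ω)
    (HI HQFT : BoseField.Fock d 𝓗 →ₗ.[ℂ] BoseField.Fock d 𝓗)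
    (hform : HQFT = BoseField.freeHamiltonian A ω + HI) (hself : IsSelfAdjoint HQFT)
    (B : BoseField.Mom d → BoseField.Fock d 𝓗 →ₗ.[ℂ] BoseField.Fock d 𝓗)
    (Ψ : BoseField.Fock d 𝓗) (hΨ : BoseField.IsGroundState HQFT Ψ)
    (hPT : BoseField.PullThrough HQFT ω B Ψ)
    (hmeas : BoseField.IsMeasurableFamily (BoseField.freeHamiltonian A ω).domain B)
    (hreg : BoseField.IsRegularAwayFromZero HQFT ω B)
    (hBbdd : ∀ k, k ≠ 0 → BoseField.IsBoundedOperator (B k))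
    (hBL2 : MemLp (fun k => (BoseField.opNorm (B k)).toReal) 2 volume) :
    BoseField.range (BoseField.hat HQFT) ≤
      (BoseField.maximalCarleman (BoseField.carlemanKernel HQFT ω B Ψ)).domain := by
  -- Weak measurability of `B(·)` is given only on `D(H₀)`; the ground state lies there because
  -- `D(HQFT) = D(H₀) ∩ D(HI)`.
  have hdom : Ψ ∈ (BoseField.freeHamiltonian A ω).domain := by
    obtain ⟨-, -, hΨdom, -⟩ := hΨ
    have h1 : Ψ ∈ HQFT.domain := hΨdom
    rw [hform] at h1
    exact h1.1
  have hsymm : HQFT.IsFormalAdjoint HQFT := by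
    have h1 := LinearPMap.adjoint_isFormalAdjoint hself.dense_domain
    rwa [show HQFT.adjoint = HQFT from hself] at h1
  have hsymm' : (BoseField.hat HQFT).IsFormalAdjoint (BoseField.hat HQFT) := by
    simpa [BoseField.hat] using
      BoseField.isFormalAdjoint_addConst hsymm (-BoseField.groundStateEnergy HQFT)
  exact BoseField.range_le_carlemanDomain hd hsymm'
    (fun _ hx => BoseField.mem_resolventSet_hat hΨ.1 hx) hω.continuous hω.pos (hmeas.2 Ψ hdom)
    (hBL2.mul_const ‖Ψ‖) fun k hk => BoseField.norm_value_le (hBbdd k hk) Ψ
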